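/- All manifolds, functions and tensor fields are of class $C^\infty$. Let $M$ be a Hausdorff manifold, let $Z$ be a vector field on $M$, and let $\pi_1,\pi_2$ be bivector fields on $M$ that define a Poisson pencil: $\pi_1$, $\pi_2$ and $\pi_\lambda:=\pi_1-\lambda\pi_2$, for every $\lambda\in\mathbb R$, are Poisson tensors, i.e. their Schouten--Nijenhuis bracket with themselves vanishes. Assume that the pencil is homogeneous with respect to $Z$, i.e. $[Z,\pi_\lambda]=-\pi_\lambda$ for every $\lambda\in\mathbb R$. Let $N$ be a (embedded or injectively immersed) submanifold of $M$ of codimension $1$ that is transverse to $Z$, i.e. $T_pM=T_pN+\mathbb R\,Z(p)$ for every $p\in N$. A Jacobi bracket on $N$ is an $\mathbb R$-bilinear, skew-symmetric map $\{\cdot,\cdot\}\colon C^\infty(N)\times C^\infty(N)\to C^\infty(N)$ that satisfies the Jacobi identity and is local, i.e. $\operatorname{supp}\{f,g\}\subseteq\operatorname{supp}f\cap\operatorname{supp}g$; by locality it also defines a bracket of functions on any open subset of $N$. Then there is a Jacobi pencil on $N$, i.e. there are Jacobi brackets $\{\cdot,\cdot\}_1$ and $\{\cdot,\cdot\}_2$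 on $N$ such that $\{\cdot,\cdot\}_\lambda:=\{\cdot,\cdot\}_1-\lambda\{\cdot,\cdot\}_2$ is a Jacobi bracket on $N$ for every $\lambda\in\mathbb R$, with the following property: for every open set $U\subseteq M$, all $f,g\in C^\infty(U)$ with $\langle Z,df\rangle=f$ and $\langle Z,dg\rangle=g$ on $U$, and every $\lambda\in\mathbb R$, $$\{f|_{N\cap U},\,g|_{N\cap U}\}_\lambda=\pi_\lambda(df,dg)|_{N\cap U}.$$ -/

import Mathlib

open scoped Manifold ContDiff Topology

noncomputable section

section Poisson

variable {E : Type*} [NormedAddCommGroup E] [NormedSpace ℝ E]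
  {H : Type*} [TopologicalSpace H] (I : ModelWithCorners ℝ E H)
  {M : Type*} [TopologicalSpace M] [ChartedSpace H M]

/-- A (not necessarily smooth) field of bilinear forms on the cotangent spaces `T*_x M`. -/
abbrev CotangentBilinField (M : Type*) [TopologicalSpace M] [ChartedSpace H M] : Type _ :=
  ∀ x : M, (TangentSpace I x →L[ℝ] ℝ) →ₗ[ℝ] (TangentSpace I x →L[ℝ] ℝ) →ₗ[ℝ] ℝ

variable {I}

/-- The function `x ↦ π_x(d_x f, d_x g)`. -/
def pairDiff (π : CotangentBilinField I M) (f g : M → ℝ) (x : M) : ℝ :=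
  π x (mvfderiv I f x) (mvfderiv I g x)

/-- `π` is a smooth bivector field: it is alternating at every point, and `π(df, dg)` is a smooth
function for all smooth functions `f`, `g` on `M` (as coordinate functions can be cut off by bump
functions, this says that the components of `π` in every chart are smooth). -/
structure IsBivectorField (π : CotangentBilinField I M) : Prop where
  alternating : ∀ (x : M) (α : TangentSpace I x →L[ℝ] ℝ), π x α α = 0
  smooth : ∀ f g : C^∞⟮I, M; ℝ⟯, ContMDiff I 𝓘(ℝ, ℝ) ∞ (pairDiff π f g)

/-- The derivative `⟨Z, df⟩` of a function along a vector field. -/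
def derivAlong (Z : ∀ x : M, TangentSpace I x) (f : M → ℝ) (x : M) : ℝ :=
  mvfderiv I f x (Z x)

/-- The value `[π, π](df, dg, dh)` of the Schouten–Nijenhuis bracket of the bivector field `π` with
itself, `2 (π(d π(df, dg), dh) + π(d π(dg, dh), df) + π(d π(dh, df), dg))`. A trivector field is
determined by its values on differentials of functions. -/
def schoutenSelf (π : CotangentBilinField I M) (f g h : M → ℝ) (x : M) : ℝ :=
  2 * (pairDiff π (pairDiff π f g) h x + pairDiff π (pairDiff π g h) f x
    + pairDiff π (pairDiff π h f) g x)

/-- The value `[Z, π](df, dg)` of the Schouten–Nijenhuis bracket (that is, the Lie derivative) of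
the bivector field `π` with the vector field `Z`,
`Z(π(df, dg)) - π(L_Z df, dg) - π(df, L_Z dg)`, where `L_Z df = d(Z f)`. -/
def schoutenVector (Z : ∀ x : M, TangentSpace I x) (π : CotangentBilinField I M)
    (f g : M → ℝ) (x : M) : ℝ :=
  derivAlong Z (pairDiff π f g) x - pairDiff π (derivAlong Z f) g x
    - pairDiff π f (derivAlong Z g) x

/-- `π` is a Poisson tensor: a smooth bivector field with `[π, π] = 0`. -/
structure IsPoissonTensor (π : CotangentBilinField I M) : Prop where
  bivector : IsBivectorField π
  schouten : ∀ (f g h : C^∞⟮I, M; ℝ⟯) (x : M), schoutenSelf π f g h x = 0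

/-- `π₁` and `π₂` are Poisson tensors and so is `π_c = π₁ - c π₂` for every real `c`. -/
structure IsPoissonPencil (π₁ π₂ : CotangentBilinField I M) : Prop where
  left : IsPoissonTensor π₁
  right : IsPoissonTensor π₂
  pencil : ∀ c : ℝ, IsPoissonTensor (π₁ - c • π₂)

/-- `[Z, π] = -π`. -/
def IsHomogeneousWrt (Z : ∀ x : M, TangentSpace I x) (π : CotangentBilinField I M) : Prop :=
  ∀ (f g : C^∞⟮I, M; ℝ⟯) (x : M), schoutenVector Z π f g x = -pairDiff π f g x

/-- The pencil `π_c = π₁ - c π₂` is homogeneous with respect to `Z`: `[Z, π_c] = -π_c` for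
every real `c`. -/
def IsHomogeneousPencil (Z : ∀ x : M, TangentSpace I x) (π₁ π₂ : CotangentBilinField I M) : Prop :=
  ∀ c : ℝ, IsHomogeneousWrt Z (π₁ - c • π₂)

/-- The map `ι` is transverse to the vector field `Z`: at every point of its source the
tangent space of the target is the sum of the image of `dι` and the line spanned by `Z`. -/
def IsTransverseTo {E' : Type*} [NormedAddCommGroup E'] [NormedSpace ℝ E']
    {H' : Type*} [TopologicalSpace H'] (J : ModelWithCorners ℝ E' H')
    {N : Type*} [TopologicalSpace N] [ChartedSpace H' N]
    (ι : N → M) (Z : ∀ x : M, TangentSpace I x) : Prop :=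
  ∀ p : N, LinearMap.range (mfderiv J I ι p : TangentSpace J p →ₗ[ℝ] TangentSpace I (ι p))
    ⊔ Submodule.span ℝ {Z (ι p)} = ⊤

end Poisson

section Jacobi

variable {E : Type*} [NormedAddCommGroup E] [NormedSpace ℝ E]
  {H : Type*} [TopologicalSpace H] {I : ModelWithCorners ℝ E H}
  {N : Type*} [TopologicalSpace N] [ChartedSpace H N]

/-- `B` is a Jacobi bracket on the manifold `N`: an `ℝ`-bilinear, skew-symmetric, local bracket on
`C^∞(N, ℝ)` that satisfies the Jacobi identity. -/
structure IsJacobiBracket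
    (B : C^∞⟮I, N; ℝ⟯ →ₗ[ℝ] C^∞⟮I, N; ℝ⟯ →ₗ[ℝ] C^∞⟮I, N; ℝ⟯) : Prop where
  skew : ∀ f g, B f g = -B g f
  jacobi : ∀ f g h, B f (B g h) + B g (B h f) + B h (B f g) = 0
  isLocal : ∀ f g, tsupport (B f g : N → ℝ) ⊆ tsupport (f : N → ℝ) ∩ tsupport (g : N → ℝ)

/-- `B₁` and `B₂` are Jacobi brackets and so is `B_c = B₁ - c B₂` for every real `c`. -/
structure IsJacobiPencil
    (B₁ B₂ : C^∞⟮I, N; ℝ⟯ →ₗ[ℝ] C^∞⟮I, N; ℝ⟯ →ₗ[ℝ] C^∞⟮I, N; ℝ⟯) : Prop where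
  left : IsJacobiBracket B₁
  right : IsJacobiBracket B₂
  pencil : ∀ c : ℝ, IsJacobiBracket (B₁ - c • B₂)

/-- The local bracket `B`, restricted to the open set `V`, satisfies `{f, g} = h` on `V`. A local
bracket acts on germs, so the value at `p` of the bracket of functions `f`, `g` that are smooth on
`V` only is the value at `p` of the bracket of any smooth functions `F`, `G` on all of `N` that
agree with `f`, `g` near `p`. -/
def LocalBracketEqOn
    (B : C^∞⟮I, N; ℝ⟯ →ₗ[ℝ] C^∞⟮I, N; ℝ⟯ →ₗ[ℝ] C^∞⟮I, N; ℝ⟯) (V : Set N) (f g h : N → ℝ) : Prop :=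
  ∀ p ∈ V, ∀ F G : C^∞⟮I, N; ℝ⟯, (F : N → ℝ) =ᶠ[𝓝 p] f → (G : N → ℝ) =ᶠ[𝓝 p] g →
    B F G p = h p

/-- The functions `F`, `G` in the preceding definition exist. -/
theorem exists_globalExtension_germ [FiniteDimensional ℝ E] [T2Space N] [IsManifold I ∞ N]
    {V : Set N} (hV : IsOpen V) {f : N → ℝ} (hf : ContMDiffOn I 𝓘(ℝ, ℝ) ∞ f V) {p : N}
    (hp : p ∈ V) : ∃ F : C^∞⟮I, N; ℝ⟯, (F : N → ℝ) =ᶠ[𝓝 p] f := by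
  obtain ⟨ρ, -, hρ⟩ := (SmoothBumpFunction.nhds_basis_tsupport (I := I) p).mem_iff.1
    (hV.mem_nhds hp)
  refine ⟨⟨fun q => ρ q * f q, ?_⟩, ?_⟩
  · refine contMDiff_of_tsupport (fun q hq => ?_)
    have hq' : q ∈ V := hρ ((closure_mono (Function.support_mul_subset_left _ _)) hq)
    exact ρ.contMDiffAt.mul (hf.contMDiffAt (hV.mem_nhds hq'))
  · filter_upwards [ρ.eventuallyEq_one] with q hq
    simp [hq]

end Jacobi

end

/-! ### First-order homogeneous extensions along a transverse map. -/

section HomogeneousExtension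

variable {E : Type*} [NormedAddCommGroup E] [NormedSpace ℝ E]
  {H : Type*} [TopologicalSpace H] {I : ModelWithCorners ℝ E H}
  {M : Type*} [TopologicalSpace M] [ChartedSpace H M]
  {E' : Type*} [NormedAddCommGroup E'] [NormedSpace ℝ E']
  {H' : Type*} [TopologicalSpace H'] {J : ModelWithCorners ℝ E' H'}
  {N : Type*} [TopologicalSpace N] [ChartedSpace H' N]
  {Z : ∀ x : M, TangentSpace I x} {ι : N → M}

/-! Put `{F, G} = π(df, dg)` along `N`, where `f`, `g` extend `F`, `G` and satisfy `Z f = f`, `Z g =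
g`. By transversality these conditions, imposed at a point of `N` only, already fix `df` there
(`mvfderiv_unique`). So no flow of `Z` is needed: a formal solution along `N` suffices. For the
Jacobi identity, `π(df, dg)` must itself be an admissible extension of `{F, G}`. Homogeneity gives
`Z(π(df, dg)) = -π(df, dg) + π(d(Zf), dg) + π(df, d(Zg))`, which equals `π(df, dg)` once also `d(Zf)
= df` and `d(Zg) = dg` at the point. Hence `Z f = f` is solved to second order, by `f₀ + u f₁ + u²
f₂` with `u` a local defining function of `N` (`exists_secondOrder_homogeneousExtension`). The
Jacobi identity is then `[π, π] = 0`. The bracket is linear in `π`, so pencils go to pencils. -/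

theorem Filter.EventuallyEq.mvfderiv_eq {f g : M → ℝ} {x : M} (h : f =ᶠ[𝓝 x] g) :
    mvfderiv I f x = mvfderiv I g x :=
  h.mfderiv_eq

theorem ContMDiffMap.mdifferentiableAt_real (f : C^∞⟮I, M; ℝ⟯) (x : M) :
    MDifferentiableAt I 𝓘(ℝ, ℝ) f x :=
  (f.contMDiff x).mdifferentiableAt (by simp)

/-- The derivative of a smooth function along a smooth vector field is smooth. -/
theorem contMDiff_derivAlong [IsManifold I ∞ M]
    (hZ : ContMDiff I I.tangent ∞ (fun x => (⟨x, Z x⟩ : TangentBundle I M)))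
    (f : C^∞⟮I, M; ℝ⟯) : ContMDiff I 𝓘(ℝ, ℝ) ∞ (derivAlong Z f) := by
  have h := (contMDiff_snd_tangentBundle_modelSpace ℝ 𝓘(ℝ, ℝ) (n := ∞)).comp
    ((f.contMDiff.contMDiff_tangentMap (m := ∞) (by simp)).comp hZ)
  exact h

theorem derivAlong_add {f g : M → ℝ} {x : M} (hf : MDifferentiableAt I 𝓘(ℝ, ℝ) f x)
    (hg : MDifferentiableAt I 𝓘(ℝ, ℝ) g x) :
    derivAlong Z (f + g) x = derivAlong Z f x + derivAlong Z g x := by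
  simp [derivAlong, mvfderiv_add hf hg]

theorem derivAlong_mul {f g : M → ℝ} {x : M} (hf : MDifferentiableAt I 𝓘(ℝ, ℝ) f x)
    (hg : MDifferentiableAt I 𝓘(ℝ, ℝ) g x) :
    derivAlong Z (f * g) x = f x * derivAlong Z g x + g x * derivAlong Z f x := by
  simp [derivAlong, mvfderiv_mul hf hg]

/-- A function is determined to first order, at a point of a transverse submanifold, by its
restriction to the submanifold and its transverse derivative. -/
theorem mvfderiv_eq_of_isTransverseTo (htr : IsTransverseTo J ι Z) {p : N}
    (hι : MDifferentiableAt J I ι p) {f g : M → ℝ}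
    (hf : MDifferentiableAt I 𝓘(ℝ, ℝ) f (ι p)) (hg : MDifferentiableAt I 𝓘(ℝ, ℝ) g (ι p))
    (hfg : f ∘ ι =ᶠ[𝓝 p] g ∘ ι) (hZ : derivAlong Z f (ι p) = derivAlong Z g (ι p)) :
    mvfderiv I f (ι p) = mvfderiv I g (ι p) := by
  have hd := hfg.mvfderiv_eq (I := J)
  rw [mvfderiv_comp p hf hι, mvfderiv_comp p hg hι] at hd
  -- The differentials agree on a subspace; it contains the image of `dι` by the chain rule, and
  -- `Z`.
  have hle : (⊤ : Submodule ℝ (TangentSpace I (ι p))) ≤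
      LinearMap.eqLocus (mvfderiv I f (ι p) : TangentSpace I (ι p) →ₗ[ℝ] ℝ)
        (mvfderiv I g (ι p) : TangentSpace I (ι p) →ₗ[ℝ] ℝ) := by
    rw [← htr p, sup_le_iff]
    constructor
    · rintro _ ⟨v, rfl⟩
      exact DFunLike.congr_fun hd v
    · rw [Submodule.span_singleton_le_iff_mem]
      exact hZ
  ext v
  exact hle (Submodule.mem_top : v ∈ ⊤)

variable (Z ι) in
/-- To first order at `ι p`, the function `f` is homogeneous of degree one along `Z` and extends
the function `F` defined on the submanifold. -/
structure IsHomogeneousExtensionAt (F : N → ℝ) (p : N) (f : M → ℝ) : Prop where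
  mdifferentiableAt : MDifferentiableAt I 𝓘(ℝ, ℝ) f (ι p)
  restrict : f ∘ ι =ᶠ[𝓝 p] F
  derivAlong_eq : derivAlong Z f (ι p) = f (ι p)

namespace IsHomogeneousExtensionAt

variable {F G : N → ℝ} {p : N} {f g : M → ℝ}

theorem congr (hf : IsHomogeneousExtensionAt Z ι F p f) (h : F =ᶠ[𝓝 p] G) :
    IsHomogeneousExtensionAt Z ι G p f :=
  ⟨hf.1, hf.2.trans h, hf.3⟩

theorem add (hf : IsHomogeneousExtensionAt Z ι F p f) (hg : IsHomogeneousExtensionAt Z ι G p g) :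
    IsHomogeneousExtensionAt Z ι (F + G) p (f + g) where
  mdifferentiableAt := hf.1.add hg.1
  restrict := hf.2.add hg.2
  derivAlong_eq := by
    rw [derivAlong_add hf.1 hg.1, hf.3, hg.3, Pi.add_apply]

theorem const_mul (hf : IsHomogeneousExtensionAt Z ι F p f) (c : ℝ) :
    IsHomogeneousExtensionAt Z ι (c • F) p ((fun _ => c) * f) where
  mdifferentiableAt := mdifferentiableAt_const.mul hf.1
  restrict := hf.2.fun_comp (c * ·)
  derivAlong_eq := by
    rw [derivAlong_mul mdifferentiableAt_const hf.1, hf.3]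
    simp [derivAlong, mvfderiv_const]

theorem zero : IsHomogeneousExtensionAt Z ι (0 : N → ℝ) p (0 : M → ℝ) where
  mdifferentiableAt := mdifferentiableAt_const
  restrict := .rfl
  derivAlong_eq := by simp [derivAlong]

theorem mvfderiv_unique (htr : IsTransverseTo J ι Z) (hι : MDifferentiableAt J I ι p)
    (hf : IsHomogeneousExtensionAt Z ι F p f) (hg : IsHomogeneousExtensionAt Z ι F p g) :
    mvfderiv I f (ι p) = mvfderiv I g (ι p) := by
  have h := hf.2.trans hg.2.symm
  refine mvfderiv_eq_of_isTransverseTo htr hι hf.1 hg.1 h ?_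
  rw [hf.3, hg.3]
  exact h.eq_of_nhds

end IsHomogeneousExtensionAt

/-! ### Extensions built from the normal form of an immersion. -/

/-- A smooth function on an immersed submanifold extends, near any point, to the ambient
manifold. -/
theorem Manifold.IsImmersionAt.exists_extension_germ [FiniteDimensional ℝ E] [T2Space M]
    [IsManifold I ∞ M] [J.Boundaryless] [I.Boundaryless] {p : N}
    (hι : Manifold.IsImmersionAt J I ∞ ι p) (F : C^∞⟮J, N; ℝ⟯) :
    ∃ f : C^∞⟮I, M; ℝ⟯, f ∘ ι =ᶠ[𝓝 p] F := by
  set φ := hι.domChart.extend J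
  set ψ := hι.codChart.extend I
  have hφo : IsOpen φ.target := hι.domChart.isOpen_extend_target
  -- In the charts `ι` reads `x ↦ (x, 0)`, so the first projection is a local left inverse of `ι`;
  -- composing `F` with it gives the extension.
  have hproj : ∀ q ∈ hι.domChart.source, (hι.equiv.symm (ψ (ι q))).1 = φ q := by
    intro q hq
    have h := hι.writtenInCharts (φ.map_source (by simpa [φ] using hq))
    have h' : φ.symm (φ q) = q := φ.left_inv (by simpa [φ] using hq)
    simp only [Function.comp_apply] at h
    change ψ (ι (φ.symm (φ q))) = _ at h
    rw [h'] at h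
    rw [h]
    simp [φ]
  have hr : ContMDiffOn I 𝓘(ℝ, E') ∞ (fun x => (hι.equiv.symm (ψ x)).1) hι.codChart.source := by
    have h1 : ContMDiff 𝓘(ℝ, E) 𝓘(ℝ, E') ∞ (fun y => (hι.equiv.symm y).1) :=
      ((ContinuousLinearMap.fst ℝ E' hι.complement).comp
        (hι.equiv.symm : E →L[ℝ] E' × hι.complement)).contMDiff
    exact h1.comp_contMDiffOn
      (OpenPartialHomeomorph.contMDiffOn_extend hι.codChart_mem_maximalAtlas)
  set V : Set M := hι.codChart.source ∩ (fun x => (hι.equiv.symm (ψ x)).1) ⁻¹' φ.target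
  have hVo : IsOpen V := hr.continuousOn.isOpen_inter_preimage hι.codChart.open_source hφo
  have hφs : ContMDiffOn 𝓘(ℝ, E') J ∞ φ.symm φ.target := by
    have h := contMDiffOn_extend_symm (I := J) hι.domChart_mem_maximalAtlas
    rwa [← OpenPartialHomeomorph.extend_target'] at h
  have hf : ContMDiffOn I 𝓘(ℝ, ℝ) ∞ (fun x => F (φ.symm (hι.equiv.symm (ψ x)).1)) V :=
    F.contMDiff.comp_contMDiffOn
      (hφs.comp (hr.mono Set.inter_subset_left) Set.inter_subset_right)
  have hpV : ι p ∈ V := by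
    refine ⟨hι.mem_codChart_source, ?_⟩
    rw [Set.mem_preimage, hproj p hι.mem_domChart_source]
    exact φ.map_source (by simpa [φ] using hι.mem_domChart_source)
  obtain ⟨f, hf⟩ := exists_globalExtension_germ hVo hf hpV
  refine ⟨f, ?_⟩
  filter_upwards [hι.continuousAt.eventually hf,
    hι.domChart.open_source.mem_nhds hι.mem_domChart_source] with q hq hq'
  rw [Function.comp_apply, hq, hproj q hq', φ.left_inv (by simpa [φ] using hq')]

/-- An immersed submanifold of positive codimension lies, near any point, in the zero set of a
function with nonzero differential. -/
theorem Manifold.IsImmersionAt.exists_definingFunction_germ [FiniteDimensional ℝ E] [T2Space M]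
    [IsManifold I ∞ M] [I.Boundaryless] {p : N}
    (hι : Manifold.IsImmersionAt J I ∞ ι p) [Nontrivial hι.complement] :
    ∃ u : C^∞⟮I, M; ℝ⟯, (∀ᶠ q in 𝓝 p, u (ι q) = 0) ∧ mvfderiv I u (ι p) ≠ 0 := by
  set φ := hι.domChart.extend J
  set ψ := hι.codChart.extend I
  obtain ⟨v, hv⟩ := exists_ne (0 : hι.complement)
  obtain ⟨ℓ, hℓ⟩ := SeparatingDual.exists_ne_zero (R := ℝ) hv
  -- A nonzero functional of the complement coordinate, which vanishes on the image `(x, 0)`.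
  set L : E →L[ℝ] ℝ := (ℓ.comp (ContinuousLinearMap.snd ℝ E' hι.complement)).comp
    (hι.equiv.symm : E →L[ℝ] E' × hι.complement)
  have hL : L ≠ 0 := by
    intro h
    apply hℓ
    simpa [L] using DFunLike.congr_fun h (hι.equiv (0, v))
  have hu : ContMDiffOn I 𝓘(ℝ, ℝ) ∞ (fun x => L (ψ x)) hι.codChart.source :=
    L.contMDiff.comp_contMDiffOn
      (OpenPartialHomeomorph.contMDiffOn_extend hι.codChart_mem_maximalAtlas)
  obtain ⟨u, hu⟩ := exists_globalExtension_germ hι.codChart.open_source hu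
    hι.mem_codChart_source
  refine ⟨u, ?_, ?_⟩
  · filter_upwards [hι.continuousAt.eventually hu,
      hι.domChart.open_source.mem_nhds hι.mem_domChart_source] with q hq hq'
    have h := hι.writtenInCharts (φ.map_source (by simpa [φ] using hq'))
    have h' : φ.symm (φ q) = q := φ.left_inv (by simpa [φ] using hq')
    simp only [Function.comp_apply] at h
    change ψ (ι (φ.symm (φ q))) = _ at h
    rw [h'] at h
    rw [hq, h]
    simp [L]
  · intro h0
    have hs : ι p ∈ ψ.source := by simpa [ψ] using hι.mem_codChart_source
    have hto : ψ.target ∈ 𝓝 (ψ (ι p)) :=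
      hι.codChart.isOpen_extend_target.mem_nhds (ψ.map_source hs)
    have hψ : ContMDiffOn 𝓘(ℝ, E) I ∞ ψ.symm ψ.target := by
      have h := contMDiffOn_extend_symm (I := I) hι.codChart_mem_maximalAtlas
      rwa [← OpenPartialHomeomorph.extend_target'] at h
    have hψ' : ContMDiffAt 𝓘(ℝ, E) I ∞ ψ.symm (ψ (ι p)) := hψ.contMDiffAt hto
    have hback : ψ.symm (ψ (ι p)) = ι p := ψ.left_inv hs
    -- Read in the chart, `u` is the linear map `L`, so `du = 0` would force `L = 0`.
    have heq : u ∘ ψ.symm =ᶠ[𝓝 (ψ (ι p))] L := by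
      have hc : Filter.Tendsto ψ.symm (𝓝 (ψ (ι p))) (𝓝 (ι p)) := by
        simpa only [hback] using hψ'.continuousAt.tendsto
      filter_upwards [hc.eventually hu, hto] with y hy hy'
      rw [Function.comp_apply, hy, ψ.right_inv hy']
    have hd := heq.mvfderiv_eq (I := 𝓘(ℝ, E))
    rw [mvfderiv_comp (ψ (ι p)) (u.mdifferentiableAt_real _)
      (hψ'.mdifferentiableAt (by simp)), hback, h0] at hd
    apply hL
    have hLd : mvfderiv 𝓘(ℝ, E) L (ψ (ι p)) = L := by
      rw [mvfderiv, mfderiv_eq_fderiv, L.fderiv]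
      rfl
    rw [← hLd, ← hd]
    exact ContinuousLinearMap.zero_comp _

/-- The formal solution, to second order along a transverse submanifold, of the equation
`Z f = f` with prescribed restriction. -/
theorem exists_secondOrder_homogeneousExtension [FiniteDimensional ℝ E] [T2Space M]
    [IsManifold I ∞ M] [J.Boundaryless] [I.Boundaryless]
    (hZ : ContMDiff I I.tangent ∞ (fun x => (⟨x, Z x⟩ : TangentBundle I M))) {p : N}
    (hι : Manifold.IsImmersionAt J I ∞ ι p) [Nontrivial hι.complement]
    (htr : IsTransverseTo J ι Z) (F : C^∞⟮J, N; ℝ⟯) :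
    ∃ f : C^∞⟮I, M; ℝ⟯, (∀ᶠ q in 𝓝 p, IsHomogeneousExtensionAt Z ι F q f) ∧
      mvfderiv I (derivAlong Z f) (ι p) = mvfderiv I f (ι p) := by
  obtain ⟨f₀, hf₀⟩ := hι.exists_extension_germ F
  obtain ⟨u, hu, hdu⟩ := hι.exists_definingFunction_germ
  let D : C^∞⟮I, M; ℝ⟯ → C^∞⟮I, M; ℝ⟯ := fun f => ⟨derivAlong Z f, contMDiff_derivAlong hZ f⟩
  have Dadd : ∀ f g, D (f + g) = D f + D g := fun f g => by
    ext x
    exact derivAlong_add (f.mdifferentiableAt_real x) (g.mdifferentiableAt_real x)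
  have Dmul : ∀ f g, D (f * g) = f * D g + g * D f := fun f g => by
    ext x
    exact derivAlong_mul (f.mdifferentiableAt_real x) (g.mdifferentiableAt_real x)
  -- Otherwise `u` would agree with `0` both along `N` and in the direction `Z`, so `du` would
  -- vanish.
  have hDu : D u (ι p) ≠ 0 := by
    intro h0
    apply hdu
    have h := mvfderiv_eq_of_isTransverseTo (f := u) (g := 0) htr
      (hι.contMDiffAt.mdifferentiableAt (by simp)) (u.mdifferentiableAt_real _)
      mdifferentiableAt_const hu (by rw [show derivAlong Z u (ι p) = 0 from h0]; simp [derivAlong])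
    rw [h, mvfderiv_zero]
  have hV : IsOpen {x | D u x ≠ 0} := isOpen_ne_fun (D u).contMDiff.continuous continuous_const
  obtain ⟨w, hw⟩ : ∃ w : C^∞⟮I, M; ℝ⟯, (w : M → ℝ) =ᶠ[𝓝 (ι p)] fun x => (D u x)⁻¹ :=
    exists_globalExtension_germ hV
      (fun x hx => ((D u).contMDiff x).contMDiffWithinAt.inv₀ hx) hDu
  -- Expanding `D f - f` in powers of `u`, the coefficients are `D f₀ - f₀ + f₁ D u`, then `D f₁ -
  -- f₁ + 2 f₂ D u`, then `k`. The choices of `f₁` and `f₂` kill the first two; the `2` comes from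
  -- `D(u²) = 2 u D u`.
  let f₁ := (f₀ - D f₀) * w
  let f₂ := (2⁻¹ : ℝ) • ((f₁ - D f₁) * w)
  let f := f₀ + (u * f₁ + u * u * f₂)
  let k := D f₂ - f₂
  have hfk : (D f : M → ℝ) =ᶠ[𝓝 (ι p)] (f + u * u * k : C^∞⟮I, M; ℝ⟯) := by
    filter_upwards [hw, hV.mem_nhds hDu] with x hx hx'
    have h : D f = D f₀ + (u * D f₁ + f₁ * D u +
        (u * u * D f₂ + f₂ * (u * D u + u * D u))) := by
      simp only [f, Dadd, Dmul]
    have h1 : f₁ x * D u x = f₀ x - D f₀ x := by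
      simp only [f₁, ContMDiffMap.coe_mul, Pi.mul_apply, hx]
      simp [inv_mul_cancel_right₀ hx']
    have h2 : 2 * (f₂ x * D u x) = f₁ x - D f₁ x := by
      have : f₂ x = 2⁻¹ * ((f₁ x - D f₁ x) * w x) := rfl
      rw [this, hx]
      field_simp
    rw [h]
    simp only [f, k, ContMDiffMap.coe_add, ContMDiffMap.coe_mul, ContMDiffMap.coe_sub,
      Pi.add_apply, Pi.mul_apply, Pi.sub_apply]
    linear_combination h1 + u x * h2
  refine ⟨f, ?_, ?_⟩
  · filter_upwards [hu, hι.continuousAt.eventually hfk, hf₀.eventually_nhds,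
      hu.eventually_nhds] with q hq hq' hq'' hu'
    refine ⟨f.mdifferentiableAt_real _, ?_, ?_⟩
    · filter_upwards [hq'', hu'] with r hr hr'
      have : (f ∘ ι) r = f₀ (ι r) + (u (ι r) * f₁ (ι r) + u (ι r) * u (ι r) * f₂ (ι r)) := rfl
      rw [this, hr', ← hr, Function.comp_apply]
      ring
    · refine hq'.trans ?_
      have : (f + u * u * k) (ι q) = f (ι q) + u (ι q) * u (ι q) * k (ι q) := rfl
      rw [this, hq]
      ring
  -- The error `u² k` has zero differential where `u = 0`.
  · have h := hfk.mvfderiv_eq (I := I)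
    have hu' := u.mdifferentiableAt_real (ι p)
    have hk' := k.mdifferentiableAt_real (ι p)
    rw [show derivAlong Z f = D f from rfl, h, ContMDiffMap.coe_add, ContMDiffMap.coe_mul,
      ContMDiffMap.coe_mul, mvfderiv_add (f.mdifferentiableAt_real _) ((hu'.mul hu').mul hk'),
      mvfderiv_mul (hu'.mul hu') hk', mvfderiv_mul hu' hu']
    simp [hu.self_of_nhds]

end HomogeneousExtension

/-! ### The bracket induced on the submanifold. -/

section InducedBracket

variable {E : Type*} [NormedAddCommGroup E] [NormedSpace ℝ E]
  {H : Type*} [TopologicalSpace H] {I : ModelWithCorners ℝ E H}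
  {M : Type*} [TopologicalSpace M] [ChartedSpace H M]
  {E' : Type*} [NormedAddCommGroup E'] [NormedSpace ℝ E']
  {H' : Type*} [TopologicalSpace H'] {J : ModelWithCorners ℝ E' H'}
  {N : Type*} [TopologicalSpace N] [ChartedSpace H' N]
  {Z : ∀ x : M, TangentSpace I x} {ι : N → M}

theorem pairDiff_congr (π : CotangentBilinField I M) {f f' g g' : M → ℝ} {x : M}
    (hf : mvfderiv I f x = mvfderiv I f' x) (hg : mvfderiv I g x = mvfderiv I g' x) :
    pairDiff π f g x = pairDiff π f' g' x := by
  rw [pairDiff, pairDiff, hf, hg]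

theorem IsBivectorField.pairDiff_swap {π : CotangentBilinField I M} (hπ : IsBivectorField π)
    (f g : M → ℝ) (x : M) : pairDiff π f g x = -pairDiff π g f x := by
  have h := hπ.alternating x (mvfderiv I f x + mvfderiv I g x)
  simp only [map_add, LinearMap.add_apply, hπ.alternating] at h
  simp only [pairDiff]
  linarith

theorem pairDiff_sub_smul (π₁ π₂ : CotangentBilinField I M) (c : ℝ) (f g : M → ℝ) :
    pairDiff (π₁ - c • π₂) f g = pairDiff π₁ f g - c • pairDiff π₂ f g :=
  rfl

variable (Z ι) in
/-- The bracket `B` on the submanifold is the restriction of `π` to functions that are homogeneous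
of degree one along `Z`. -/
def IsInducedBracket (π : CotangentBilinField I M)
    (B : C^∞⟮J, N; ℝ⟯ →ₗ[ℝ] C^∞⟮J, N; ℝ⟯ →ₗ[ℝ] C^∞⟮J, N; ℝ⟯) : Prop :=
  ∀ (F G : C^∞⟮J, N; ℝ⟯) (p : N) (f g : M → ℝ), IsHomogeneousExtensionAt Z ι F p f →
    IsHomogeneousExtensionAt Z ι G p g → B F G p = pairDiff π f g (ι p)

/-- First-order extensions suffice: their differentials are unique, so the value does not depend on
the extension, and sums and multiples of extensions are extensions. -/
theorem exists_isInducedBracket {π : CotangentBilinField I M} (hπ : IsBivectorField π)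
    (hι : ContMDiff J I ∞ ι) (htr : IsTransverseTo J ι Z)
    (hext : ∀ (p : N) (F : C^∞⟮J, N; ℝ⟯),
      ∃ f : C^∞⟮I, M; ℝ⟯, ∀ᶠ q in 𝓝 p, IsHomogeneousExtensionAt Z ι F q f) :
    ∃ B : C^∞⟮J, N; ℝ⟯ →ₗ[ℝ] C^∞⟮J, N; ℝ⟯ →ₗ[ℝ] C^∞⟮J, N; ℝ⟯, IsInducedBracket Z ι π B := by
  choose (e : N → C^∞⟮J, N; ℝ⟯ → C^∞⟮I, M; ℝ⟯) he using hext
  have he' : ∀ p (F : C^∞⟮J, N; ℝ⟯), IsHomogeneousExtensionAt Z ι F p (e p F) := fun p F => (he p F).self_of_nhds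
  let b : C^∞⟮J, N; ℝ⟯ → C^∞⟮J, N; ℝ⟯ → N → ℝ := fun F G p => pairDiff π (e p F) (e p G) (ι p)
  have hb : ∀ (F G : C^∞⟮J, N; ℝ⟯) (p : N) (f g : M → ℝ), IsHomogeneousExtensionAt Z ι F p f →
      IsHomogeneousExtensionAt Z ι G p g → b F G p = pairDiff π f g (ι p) := by
    intro F G p f g hf hg
    have hp := (hι p).mdifferentiableAt (by simp)
    exact pairDiff_congr π ((he' p F).mvfderiv_unique htr hp hf)
      ((he' p G).mvfderiv_unique htr hp hg)
  have hsmooth : ∀ F G, ContMDiff J 𝓘(ℝ, ℝ) ∞ (b F G) := by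
    intro F G p
    -- The extensions chosen at `p` are also valid at nearby `q`, so near `p` one fixed pair
    -- computes the bracket.
    refine (((hπ.smooth (e p F) (e p G)).comp hι) p).congr_of_eventuallyEq ?_
    filter_upwards [he p F, he p G] with q hF hG
    exact hb F G q _ _ hF hG
  refine ⟨LinearMap.mk₂ ℝ (fun F G => ⟨b F G, hsmooth F G⟩) ?_ ?_ ?_ ?_, hb⟩
  · intro F F' G
    ext p
    change b (F + F') G p = b F G p + b F' G p
    rw [hb (F + F') G p _ _ ((he' p F).add (he' p F')) (he' p G)]
    simp [b, pairDiff, mvfderiv_add (he' p F).1 (he' p F').1]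
  · intro c F G
    ext p
    change b (c • F) G p = c * b F G p
    rw [hb (c • F) G p _ _ ((he' p F).const_mul c) (he' p G)]
    simp [b, pairDiff, mvfderiv_mul mdifferentiableAt_const (he' p F).1, mvfderiv_const]
  · intro F G G'
    ext p
    change b F (G + G') p = b F G p + b F G' p
    rw [hb F (G + G') p _ _ (he' p F) ((he' p G).add (he' p G'))]
    simp [b, pairDiff, mvfderiv_add (he' p G).1 (he' p G').1]
  · intro c F G
    ext p
    change b F (c • G) p = c * b F G p
    rw [hb F (c • G) p _ _ (he' p F) ((he' p G).const_mul c)]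
    simp [b, pairDiff, mvfderiv_mul mdifferentiableAt_const (he' p G).1, mvfderiv_const]

namespace IsInducedBracket

variable {π : CotangentBilinField I M}
  {B : C^∞⟮J, N; ℝ⟯ →ₗ[ℝ] C^∞⟮J, N; ℝ⟯ →ₗ[ℝ] C^∞⟮J, N; ℝ⟯}

theorem sub_smul {π₁ π₂ : CotangentBilinField I M}
    {B₁ B₂ : C^∞⟮J, N; ℝ⟯ →ₗ[ℝ] C^∞⟮J, N; ℝ⟯ →ₗ[ℝ] C^∞⟮J, N; ℝ⟯}
    (h₁ : IsInducedBracket Z ι π₁ B₁) (h₂ : IsInducedBracket Z ι π₂ B₂) (c : ℝ) :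
    IsInducedBracket Z ι (π₁ - c • π₂) (B₁ - c • B₂) := by
  intro F G p f g hf hg
  change B₁ F G p - c * B₂ F G p = pairDiff π₁ f g (ι p) - c * pairDiff π₂ f g (ι p)
  rw [h₁ F G p f g hf hg, h₂ F G p f g hf hg]

theorem localBracketEqOn (hB : IsInducedBracket Z ι π B) {U : Set M} (hU : IsOpen U) {f g : M → ℝ}
    (hf : ContMDiffOn I 𝓘(ℝ, ℝ) ∞ f U) (hg : ContMDiffOn I 𝓘(ℝ, ℝ) ∞ g U)
    (hZf : ∀ x ∈ U, derivAlong Z f x = f x) (hZg : ∀ x ∈ U, derivAlong Z g x = g x) :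
    LocalBracketEqOn B (ι ⁻¹' U) (f ∘ ι) (g ∘ ι) (pairDiff π f g ∘ ι) := by
  intro p hp F G hF hG
  have hp' := hU.mem_nhds hp
  exact hB F G p f g
    ⟨(hf.contMDiffAt hp').mdifferentiableAt (by simp), hF.symm, hZf _ hp⟩
    ⟨(hg.contMDiffAt hp').mdifferentiableAt (by simp), hG.symm, hZg _ hp⟩

/-- A homogeneous Poisson tensor induces a Jacobi bracket on a transverse submanifold. -/
theorem isJacobiBracket (hB : IsInducedBracket Z ι π B) (hπ : IsPoissonTensor π)
    (hhom : IsHomogeneousWrt Z π)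
    (hext : ∀ (p : N) (F : C^∞⟮J, N; ℝ⟯),
      ∃ f : C^∞⟮I, M; ℝ⟯, (∀ᶠ q in 𝓝 p, IsHomogeneousExtensionAt Z ι F q f) ∧
        mvfderiv I (derivAlong Z f) (ι p) = mvfderiv I f (ι p)) :
    IsJacobiBracket B := by
  have hskew : ∀ F G, B F G = -B G F := by
    intro F G
    ext p
    obtain ⟨f, hf, -⟩ := hext p F
    obtain ⟨g, hg, -⟩ := hext p G
    change B F G p = -(B G F p)
    rw [hB F G p f g hf.self_of_nhds hg.self_of_nhds,
      hB G F p g f hg.self_of_nhds hf.self_of_nhds, hπ.bivector.pairDiff_swap]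
  have hsupp : ∀ F G : C^∞⟮J, N; ℝ⟯, tsupport (B F G : N → ℝ) ⊆ tsupport (F : N → ℝ) := by
    intro F G p hp
    by_contra hF
    rw [notMem_tsupport_iff_eventuallyEq] at hF
    refine notMem_tsupport_iff_eventuallyEq.2 ?_ hp
    filter_upwards [hF.eventuallyEq_nhds] with q hq
    obtain ⟨g, hg, -⟩ := hext q G
    -- Where `F` vanishes near `q`, the zero function is an admissible extension.
    rw [hB F G q 0 g (IsHomogeneousExtensionAt.zero.congr hq.symm) hg.self_of_nhds]
    simp [pairDiff]
  refine ⟨hskew, ?_, fun F G => Set.subset_inter (hsupp F G) ?_⟩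
  · intro F G K
    ext p
    obtain ⟨f, hf, hdf⟩ := hext p F
    obtain ⟨g, hg, hdg⟩ := hext p G
    obtain ⟨k, hk, hdk⟩ := hext p K
    -- Extensions are closed under `π`; this is where `[Z, π] = -π` and the second-order condition
    -- enter.
    have key : ∀ (F G : C^∞⟮J, N; ℝ⟯) (f g : C^∞⟮I, M; ℝ⟯),
        (∀ᶠ q in 𝓝 p, IsHomogeneousExtensionAt Z ι F q f) →
        (∀ᶠ q in 𝓝 p, IsHomogeneousExtensionAt Z ι G q g) →
        mvfderiv I (derivAlong Z f) (ι p) = mvfderiv I f (ι p) →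
        mvfderiv I (derivAlong Z g) (ι p) = mvfderiv I g (ι p) →
        IsHomogeneousExtensionAt Z ι (B F G) p (pairDiff π f g) := by
      intro F G f g hf hg hdf hdg
      refine ⟨(hπ.bivector.smooth f g _).mdifferentiableAt (by simp), ?_, ?_⟩
      · filter_upwards [hf, hg] with q hf hg
        exact (hB F G q f g hf hg).symm
      · have h := hhom f g (ι p)
        rw [schoutenVector, pairDiff_congr π hdf rfl, pairDiff_congr π rfl hdg] at h
        linarith
    have hS := hπ.schouten f g k (ι p)
    have h1 := hB F (B G K) p f _ hf.self_of_nhds (key G K g k hg hk hdg hdk)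
    have h2 := hB G (B K F) p g _ hg.self_of_nhds (key K F k f hk hf hdk hdf)
    have h3 := hB K (B F G) p k _ hk.self_of_nhds (key F G f g hf hg hdf hdg)
    rw [hπ.bivector.pairDiff_swap] at h1 h2 h3
    change B F (B G K) p + B G (B K F) p + B K (B F G) p = 0
    rw [schoutenSelf] at hS
    linarith
  · rw [hskew F G, ContMDiffMap.coe_neg, tsupport_neg]
    exact hsupp G F

end IsInducedBracket

/-- The first tensor of a homogeneous pencil is homogeneous. -/
theorem IsHomogeneousPencil.left {π₁ π₂ : CotangentBilinField I M}
    (hhom : IsHomogeneousPencil Z π₁ π₂) : IsHomogeneousWrt Z π₁ := by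
  have h : π₁ - (0 : ℝ) • π₂ = π₁ := by
    funext x
    refine LinearMap.ext fun α => LinearMap.ext fun β => ?_
    change π₁ x α β - 0 * π₂ x α β = π₁ x α β
    ring
  exact h ▸ hhom 0

/-- The second tensor of a homogeneous pencil is homogeneous. -/
theorem IsHomogeneousPencil.right {π₁ π₂ : CotangentBilinField I M} (hπ : IsPoissonPencil π₁ π₂)
    (hhom : IsHomogeneousPencil Z π₁ π₂) : IsHomogeneousWrt Z π₂ := by
  intro f g x
  -- `π₂` is the difference of the pencil members at `c = 0` and `c = 1`, and `[Z, ·]` is linear.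
  have h0 := hhom.left f g x
  have h1 := hhom 1 f g x
  have hsub : ∀ f g : M → ℝ,
      pairDiff (π₁ - (1 : ℝ) • π₂) f g = pairDiff π₁ f g - pairDiff π₂ f g := by
    intro f g
    rw [pairDiff_sub_smul, one_smul]
  have hd : derivAlong Z (pairDiff π₁ f g - pairDiff π₂ f g) x =
      derivAlong Z (pairDiff π₁ f g) x - derivAlong Z (pairDiff π₂ f g) x := by
    rw [derivAlong, mvfderiv_sub ((hπ.left.bivector.smooth f g x).mdifferentiableAt (by simp))
      ((hπ.right.bivector.smooth f g x).mdifferentiableAt (by simp))]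
    rfl
  simp only [schoutenVector, hsub, hd, Pi.sub_apply] at h0 h1 ⊢
  linarith

end InducedBracket

/-! ### Codimension one and the Jacobi pencil. -/

/-- An immersion into a manifold of larger dimension has a nontrivial complement. -/
theorem Manifold.IsImmersionAt.nontrivial_complement_of_finrank_lt
    {E : Type*} [NormedAddCommGroup E] [NormedSpace ℝ E]
    {H : Type*} [TopologicalSpace H] {I : ModelWithCorners ℝ E H}
    {M : Type*} [TopologicalSpace M] [ChartedSpace H M]
    {E' : Type*} [NormedAddCommGroup E'] [NormedSpace ℝ E']
    {H' : Type*} [TopologicalSpace H'] {J : ModelWithCorners ℝ E' H'}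
    {N : Type*} [TopologicalSpace N] [ChartedSpace H' N] {ι : N → M} {p : N}
    (hι : Manifold.IsImmersionAt J I ∞ ι p)
    (h : Module.finrank ℝ E' < Module.finrank ℝ E) : Nontrivial hι.complement := by
  by_contra hs
  rw [not_nontrivial_iff_subsingleton] at hs
  have h1 := hι.equiv.toLinearEquiv.finrank_eq
  let : Unique hι.complement := uniqueOfSubsingleton 0
  have h2 := (LinearEquiv.prodUnique (R := ℝ) (M := E') (M₂ := hι.complement)).finrank_eq
  omega

theorem mainTheorem5 (n : ℕ)
    {M : Type*} [TopologicalSpace M] [T2Space M]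
    [ChartedSpace (EuclideanSpace ℝ (Fin (n + 1))) M] [IsManifold (𝓡 (n + 1)) ∞ M]
    {N : Type*} [TopologicalSpace N] [T2Space N]
    [ChartedSpace (EuclideanSpace ℝ (Fin n)) N] [IsManifold (𝓡 n) ∞ N]
    (Z : ∀ x : M, TangentSpace (𝓡 (n + 1)) x)
    (hZ : ContMDiff (𝓡 (n + 1)) (𝓡 (n + 1)).tangent ∞
      (fun x => (⟨x, Z x⟩ : TangentBundle (𝓡 (n + 1)) M)))
    (π₁ π₂ : CotangentBilinField (𝓡 (n + 1)) M)
    (hπ : IsPoissonPencil π₁ π₂) (hhom : IsHomogeneousPencil Z π₁ π₂)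
    (ι : N → M) (hι : Manifold.IsImmersion (𝓡 n) (𝓡 (n + 1)) ∞ ι) (hinj : Function.Injective ι)
    (htr : IsTransverseTo (𝓡 n) ι Z) :
    ∃ B₁ B₂ : C^∞⟮𝓡 n, N; ℝ⟯ →ₗ[ℝ] C^∞⟮𝓡 n, N; ℝ⟯ →ₗ[ℝ] C^∞⟮𝓡 n, N; ℝ⟯,
      IsJacobiPencil B₁ B₂ ∧
      ∀ (U : Set M), IsOpen U → ∀ f g : M → ℝ,
        ContMDiffOn (𝓡 (n + 1)) 𝓘(ℝ, ℝ) ∞ f U → ContMDiffOn (𝓡 (n + 1)) 𝓘(ℝ, ℝ) ∞ g U →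
        (∀ x ∈ U, derivAlong Z f x = f x) → (∀ x ∈ U, derivAlong Z g x = g x) →
        ∀ c : ℝ, LocalBracketEqOn (B₁ - c • B₂) (ι ⁻¹' U) (f ∘ ι) (g ∘ ι)
          (pairDiff (π₁ - c • π₂) f g ∘ ι) := by
  have hlt : Module.finrank ℝ (EuclideanSpace ℝ (Fin n)) <
      Module.finrank ℝ (EuclideanSpace ℝ (Fin (n + 1))) := by simp
  have hext : ∀ (p : N) (F : C^∞⟮𝓡 n, N; ℝ⟯), ∃ f : C^∞⟮𝓡 (n + 1), M; ℝ⟯,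
      (∀ᶠ q in 𝓝 p, IsHomogeneousExtensionAt Z ι F q f) ∧
        mvfderiv (𝓡 (n + 1)) (derivAlong Z f) (ι p) = mvfderiv (𝓡 (n + 1)) f (ι p) := by
    intro p F
    have := (hι.isImmersionAt p).nontrivial_complement_of_finrank_lt hlt
    exact exists_secondOrder_homogeneousExtension hZ (hι.isImmersionAt p) htr F
  have hext' := fun p F => (hext p F).imp fun _ h => h.1
  obtain ⟨B₁, h₁⟩ := exists_isInducedBracket hπ.left.bivector hι.contMDiff htr hext'
  obtain ⟨B₂, h₂⟩ := exists_isInducedBracket hπ.right.bivector hι.contMDiff htr hext'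
  refine ⟨B₁, B₂, ⟨?_, ?_, fun c => ?_⟩, fun U hU f g hf hg hZf hZg c => ?_⟩
  · exact h₁.isJacobiBracket hπ.left hhom.left hext
  · exact h₂.isJacobiBracket hπ.right (hhom.right hπ) hext
  · exact (h₁.sub_smul h₂ c).isJacobiBracket (hπ.pencil c) (hhom c) hext
  · exact (h₁.sub_smul h₂ c).localBracketEqOn hU hf hg hZf hZg
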